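/- Let $$\Delta(s)=P_0(s)+\sum_{i=1}^{N}P_i(s)\,e^{-\zeta_i s^{\beta_i}},\qquad P_0(s)=s^{\alpha_n}+a_{n-1}s^{\alpha_{n-1}}+\dots+a_1s^{\alpha_1}+a_0,\qquad P_i(s)=\sum_{k=1}^{M_i}a_{ik}s^{\alpha_{ik}},$$ where $n\ge 1$, $N\ge 0$, $\alpha_n>\alpha_{n-1}>\dots>\alpha_1>0$, $\alpha_{ik}\ge 0$, $\zeta_i,\beta_i>0$, all coefficients $a_k,a_{ik}$ are real, and all powers of $s$ are principal powers (first Riemann sheet, branch cut on $\mathbb{R}^-$). (a) Suppose that 1. $\Delta(s)$ tends to a nonzero constant $\Delta(0^+)$ as $s\to 0$, $s\ne 0$, $\operatorname{Re}s\ge 0$; 2. $\Delta(i\omega)\neq 0$ for all real $\omega\ne 0$; 3. $s\,\Delta'(s)/\Delta(s)\to\alpha_n$ on the large arc $s=Re^{i\theta}$, $|\theta|\le\pi/2$, as $R\to\infty$, in the sense that $$\lim_{R\to\infty}\int_{-\pi/2}^{\pi/2}\left|\frac{Re^{i\theta}\,\Delta'(Re^{i\theta})}{\Delta(Re^{i\theta})}-\alpha_n\right|d\theta=0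 .$$ Then $\Delta$ has only finitely many roots in the closed right half-plane $\{\operatorname{Re}s\ge0\}$ of the first Riemann sheet, the improper integral below converges (as the limit of $\int_\varepsilon^{R}$ for $\varepsilon\to0^+$, $R\to\infty$ independently), and the number $M$ of these roots, counted with multiplicity, is $$M=\frac{\alpha_n}{2}-\frac1\pi\int_{0^+}^{\infty}\operatorname{Re}\left\{\frac{\Delta'(i\omega)}{\Delta(i\omega)}\right\}d\omega .$$ (b) Condition 3 holds whenever, for every $i=1,\dots,N$, either $\beta_i<1$, or $\beta_i=1$ and $\alpha_{ik}<\alpha_n$ for all $k$. -/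

import Mathlib

open Filter Topology MeasureTheory

/-- The data of a fractional-delay characteristic function
`Δ(s) = P₀(s) + ∑ᵢ Pᵢ(s) exp(-ζᵢ s ^ βᵢ)`, where
`P₀(s) = s ^ αₙ + ∑_{1 ≤ k < n} aₖ s ^ αₖ + a₀` with `αₙ > ⋯ > α₁ > 0` and `n = m + 1`, and
`Pᵢ(s) = ∑ₖ bᵢₖ s ^ γᵢₖ`.  All coefficients and exponents are real.  Exponents `γᵢₖ = 0`
(constant terms of `Pᵢ`) are allowed. -/
structure FractionalDelay where
  /-- `m = n - 1`, the number of non-leading, non-constant terms of `P₀` -/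
  m : ℕ
  /-- the exponents `α₁ < ⋯ < αₙ` of `P₀` -/
  α : Fin (m + 1) → ℝ
  α_strictMono : StrictMono α
  α_pos : ∀ k, 0 < α k
  /-- the coefficients `a₁, …, aₙ₋₁` of `P₀` -/
  a : Fin m → ℝ
  /-- the constant term of `P₀` -/
  a₀ : ℝ
  /-- the number of delay terms -/
  N : ℕ
  /-- the number of terms of `Pᵢ` -/
  M : Fin N → ℕ
  b : (i : Fin N) → Fin (M i) → ℝ
  γ : (i : Fin N) → Fin (M i) → ℝ
  γ_nonneg : ∀ i k, 0 ≤ γ i k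
  ζ : Fin N → ℝ
  ζ_pos : ∀ i, 0 < ζ i
  β : Fin N → ℝ
  β_pos : ∀ i, 0 < β i

namespace FractionalDelay

/-- The leading exponent `αₙ` of `P₀`. -/
def leadingExp (D : FractionalDelay) : ℝ := D.α (Fin.last D.m)

/-- `P₀` on the first Riemann sheet (principal powers, branch cut on the negative real axis). -/
noncomputable def P₀ (D : FractionalDelay) (s : ℂ) : ℂ :=
  s ^ (D.leadingExp : ℂ) + ∑ k : Fin D.m, (D.a k : ℂ) * s ^ (D.α k.castSucc : ℂ) + (D.a₀ : ℂ)

/-- `Pᵢ` on the first Riemann sheet. -/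
noncomputable def P (D : FractionalDelay) (i : Fin D.N) (s : ℂ) : ℂ :=
  ∑ k : Fin (D.M i), (D.b i k : ℂ) * s ^ (D.γ i k : ℂ)

/-- The characteristic function `Δ` on the first Riemann sheet. -/
noncomputable def Δ (D : FractionalDelay) (s : ℂ) : ℂ :=
  D.P₀ s + ∑ i : Fin D.N, D.P i s * Complex.exp (-(D.ζ i : ℂ) * s ^ (D.β i : ℂ))

/-- The roots of `Δ` in the closed right half-plane of the first Riemann sheet. -/
def unstableRoots (D : FractionalDelay) : Set ℂ := {s | 0 ≤ s.re ∧ D.Δ s = 0}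

/-- The number of roots in the closed right half-plane, counted with multiplicity
(meaningful when `D.unstableRoots` is finite). -/
noncomputable def numUnstableRoots (D : FractionalDelay) : ℕ :=
  ∑ᶠ s ∈ D.unstableRoots, analyticOrderNatAt D.Δ s

/-- `Δ(0⁺)` is a nonzero constant: `Δ` has a nonzero limit at the origin from within the closed
right half-plane. -/
def NonzeroAtOrigin (D : FractionalDelay) : Prop :=
  ∃ c : ℂ, c ≠ 0 ∧ Tendsto D.Δ (𝓝[{s | 0 ≤ s.re} \ {0}] 0) (𝓝 c)

/-- `s Δ'(s) / Δ(s) → αₙ` on the large arc `s = R e^{iθ}`, `-π/2 ≤ θ ≤ π/2`, as `R → ∞`, where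
the convergence is in the mean with respect to `θ`.  (The lower integral is `∞` if `Δ'/Δ` is not
integrable on the arc.) -/
def LargeArcLimit (D : FractionalDelay) : Prop :=
  Tendsto (fun R : ℝ => ∫⁻ θ in Set.Icc (-(Real.pi / 2)) (Real.pi / 2),
      ‖(R * Complex.exp (θ * Complex.I)) * deriv D.Δ (R * Complex.exp (θ * Complex.I)) /
          D.Δ (R * Complex.exp (θ * Complex.I)) - (D.leadingExp : ℂ)‖ₑ)
    atTop (𝓝 0)

end FractionalDelay

/-! The substitution `s = exp w` carries the strip `|im w| ≤ π/2` bijectively onto the closed right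
half-plane without the origin, and turns `Δ` into the entire function `logΔ`. The indented half-disc
contour becomes a rectangle, the branch point recedes to `re w → -∞`, and multiplicities are kept
because `exp' ≠ 0`. Since `logDeriv logΔ w = s Δ'(s) / Δ(s)`, the argument principle on a rectangle
(`rectIntegral_logDeriv`) counts the roots.

For (a), the left edge contributes 0 in the limit, because `logΔ' → 0` while `logΔ → Δ(0) ≠ 0`; the
right edge contributes `π αₙ` by the arc condition. Real coefficients make the integrands on the two
horizontal edges conjugate, so together they contribute `-2 ∫ Re (Δ'/Δ)(iω) dω` to the imaginary
part (`rectIntegral_logDeriv_logΔ_im`). Hence `2πM = π αₙ - 2 ∫`, and convergence of the integral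
follows from that of the vertical edges. Finiteness comes from the arc condition too: a zero on an
arc would make `Δ'/Δ` non-integrable there, so for large `R` the arcs carry no zeros.

For (b), numerator and denominator of `(s Δ' - αₙ Δ) / Δ` are multiplied by `s ^ (-αₙ)`. The
denominator then tends to 1, and the leading terms of the numerator cancel. For `β < 1` the delay
factors decay faster than any power of `s`; for `β = 1` they need not decay near the imaginary axis,
and Jordan's inequality gives convergence in the mean (`tendstoZeroInMean_exp_mul_delay_one`). -/

/-! ### Contour integrals over rectangles. -/

section RectangleIntegral

open Complex Set

/-- The counterclockwise integral of `F` over the boundary of `[x₀, x₁] × [y₀, y₁]`. -/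
noncomputable def rectIntegral (F : ℂ → ℂ) (x₀ x₁ y₀ y₁ : ℝ) : ℂ :=
  (∫ x : ℝ in x₀..x₁, F (x + y₀ * I)) - (∫ x : ℝ in x₀..x₁, F (x + y₁ * I)) +
    I * (∫ y : ℝ in y₀..y₁, F (x₁ + y * I)) - I * (∫ y : ℝ in y₀..y₁, F (x₀ + y * I))

/-- The boundary of the rectangle `[x₀, x₁] × [y₀, y₁]`. -/
def rectBoundary (x₀ x₁ y₀ y₁ : ℝ) : Set ℂ :=
  ((uIcc x₀ x₁) ×ℂ {y₀, y₁}) ∪ ({x₀, x₁} ×ℂ (uIcc y₀ y₁))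

variable {x₀ x₁ y₀ y₁ : ℝ} {F G : ℂ → ℂ}

lemma intervalIntegrable_horizontal_of_continuousOn {y : ℝ}
    (hF : ContinuousOn F (rectBoundary x₀ x₁ y₀ y₁)) (hy : y = y₀ ∨ y = y₁) :
    IntervalIntegrable (fun x : ℝ => F (x + y * I)) volume x₀ x₁ := by
  refine (hF.comp (by fun_prop) fun x hx => ?_).intervalIntegrable
  left
  simpa [mem_reProdIm] using ⟨hx, hy⟩

lemma intervalIntegrable_vertical_of_continuousOn {x : ℝ}
    (hF : ContinuousOn F (rectBoundary x₀ x₁ y₀ y₁)) (hx : x = x₀ ∨ x = x₁) :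
    IntervalIntegrable (fun y : ℝ => F (x + y * I)) volume y₀ y₁ := by
  refine (hF.comp (by fun_prop) fun y hy => ?_).intervalIntegrable
  right
  simpa [mem_reProdIm] using ⟨hx, hy⟩

lemma rectIntegral_add (hF : ContinuousOn F (rectBoundary x₀ x₁ y₀ y₁))
    (hG : ContinuousOn G (rectBoundary x₀ x₁ y₀ y₁)) :
    rectIntegral (fun w => F w + G w) x₀ x₁ y₀ y₁ =
      rectIntegral F x₀ x₁ y₀ y₁ + rectIntegral G x₀ x₁ y₀ y₁ := by
  unfold rectIntegral
  rw [intervalIntegral.integral_add (intervalIntegrable_horizontal_of_continuousOn hF (.inl rfl))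
      (intervalIntegrable_horizontal_of_continuousOn hG (.inl rfl)),
    intervalIntegral.integral_add (intervalIntegrable_horizontal_of_continuousOn hF (.inr rfl))
      (intervalIntegrable_horizontal_of_continuousOn hG (.inr rfl)),
    intervalIntegral.integral_add (intervalIntegrable_vertical_of_continuousOn hF (.inl rfl))
      (intervalIntegrable_vertical_of_continuousOn hG (.inl rfl)),
    intervalIntegral.integral_add (intervalIntegrable_vertical_of_continuousOn hF (.inr rfl))
      (intervalIntegrable_vertical_of_continuousOn hG (.inr rfl))]
  ring

lemma rectIntegral_const_mul (c : ℂ) :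
    rectIntegral (fun w => c * F w) x₀ x₁ y₀ y₁ = c * rectIntegral F x₀ x₁ y₀ y₁ := by
  simp only [rectIntegral, intervalIntegral.integral_const_mul]
  ring

lemma rectIntegral_sum {ι : Type*} (s : Finset ι) {F : ι → ℂ → ℂ}
    (hF : ∀ i ∈ s, ContinuousOn (F i) (rectBoundary x₀ x₁ y₀ y₁)) :
    rectIntegral (fun w => ∑ i ∈ s, F i w) x₀ x₁ y₀ y₁ =
      ∑ i ∈ s, rectIntegral (F i) x₀ x₁ y₀ y₁ := by
  classical
  induction s using Finset.induction_on with
  | empty => simp [rectIntegral]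
  | insert i s hi ih =>
    simp only [Finset.sum_insert hi]
    rw [rectIntegral_add (hF i (by simp))
      (continuousOn_finsetSum _ fun j hj => hF j (by simp [hj])),
      ih fun j hj => hF j (by simp [hj])]

lemma rectIntegral_congr (h : EqOn F G (rectBoundary x₀ x₁ y₀ y₁)) :
    rectIntegral F x₀ x₁ y₀ y₁ = rectIntegral G x₀ x₁ y₀ y₁ := by
  have hh : ∀ y, (y = y₀ ∨ y = y₁) →
      ∫ x : ℝ in x₀..x₁, F (x + y * I) = ∫ x : ℝ in x₀..x₁, G (x + y * I) := fun y hy =>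
    intervalIntegral.integral_congr fun x hx => h (by
      left; simpa [mem_reProdIm] using ⟨hx, hy⟩)
  have hv : ∀ x, (x = x₀ ∨ x = x₁) →
      ∫ y : ℝ in y₀..y₁, F (x + y * I) = ∫ y : ℝ in y₀..y₁, G (x + y * I) := fun x hx =>
    intervalIntegral.integral_congr fun y hy => h (by
      right; simpa [mem_reProdIm] using ⟨hx, hy⟩)
  simp only [rectIntegral, hh _ (.inl rfl), hh _ (.inr rfl), hv _ (.inl rfl), hv _ (.inr rfl)]

lemma log_sub_log_neg_of_im_pos {z : ℂ} (hz : 0 < z.im) :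
    log z - log (-z) = Real.pi * I := by
  simp only [log, norm_neg, arg_neg_eq_arg_sub_pi_of_im_pos hz]
  push_cast
  ring

lemma log_neg_sub_log_of_im_neg {z : ℂ} (hz : z.im < 0) :
    log (-z) - log z = Real.pi * I := by
  simpa using log_sub_log_neg_of_im_pos (z := -z) (by simpa using hz)

lemma integral_inv_sub_horizontal {w : ℂ} {y : ℝ} (hy : y ≠ w.im) :
    ∫ x : ℝ in x₀..x₁, ((x + y * I : ℂ) - w)⁻¹ =
      log (x₁ + y * I - w) - log (x₀ + y * I - w) := by
  have hs : ∀ x : ℝ, (x + y * I : ℂ) - w ∈ slitPlane := fun x => by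
    right; simpa [sub_eq_zero] using hy
  refine intervalIntegral.integral_eq_sub_of_hasDerivAt
    (f := fun x : ℝ => log ((x + y * I : ℂ) - w)) (fun x _ => ?_) ?_
  · have := (((hasDerivAt_id x).ofReal_comp.add_const ((y : ℂ) * I)).sub_const w).clog_real (hs x)
    simpa using this
  · refine Continuous.intervalIntegrable (Continuous.inv₀ (by fun_prop) fun x => ?_) _ _
    exact slitPlane_ne_zero (hs x)

lemma integral_inv_sub_vertical_of_gt {w : ℂ} {x : ℝ} (hx : w.re < x) :
    I * ∫ y : ℝ in y₀..y₁, ((x + y * I : ℂ) - w)⁻¹ =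
      log (x + y₁ * I - w) - log (x + y₀ * I - w) := by
  have hs : ∀ y : ℝ, (x + y * I : ℂ) - w ∈ slitPlane := fun y => by
    left; simpa using hx
  rw [← intervalIntegral.integral_const_mul]
  refine intervalIntegral.integral_eq_sub_of_hasDerivAt
    (f := fun y : ℝ => log ((x + y * I : ℂ) - w)) (fun y _ => ?_) ?_
  · have := ((((hasDerivAt_id y).ofReal_comp.mul_const I).const_add (x : ℂ)).sub_const w).clog_real
      (hs y)
    simpa [div_eq_mul_inv] using this
  · refine Continuous.intervalIntegrable (continuous_const.mul
      (Continuous.inv₀ (by fun_prop) fun y => ?_)) _ _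
    exact slitPlane_ne_zero (hs y)

lemma integral_inv_sub_vertical_of_lt {w : ℂ} {x : ℝ} (hx : x < w.re) :
    I * ∫ y : ℝ in y₀..y₁, ((x + y * I : ℂ) - w)⁻¹ =
      log (-(x + y₁ * I - w)) - log (-(x + y₀ * I - w)) := by
  have hs : ∀ y : ℝ, -((x + y * I : ℂ) - w) ∈ slitPlane := fun y => by
    left; simpa using hx
  rw [← intervalIntegral.integral_const_mul]
  refine intervalIntegral.integral_eq_sub_of_hasDerivAt
    (f := fun y : ℝ => log (-((x + y * I : ℂ) - w))) (fun y _ => ?_) ?_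
  · have := ((((hasDerivAt_id y).ofReal_comp.mul_const I).const_add (x : ℂ)).sub_const
      w).neg.clog_real (hs y)
    refine this.congr_deriv ?_
    simp only [Pi.neg_apply, neg_div_neg_eq]
    simp [div_eq_mul_inv]
  · refine Continuous.intervalIntegrable (continuous_const.mul
      (Continuous.inv₀ (by fun_prop) fun y => ?_)) _ _
    exact neg_ne_zero.1 (slitPlane_ne_zero (hs y))

/-- Three edges have `log (z - w)` as a primitive. The left edge crosses the branch cut, so `log
(-(z - w))` serves there. The sum telescopes except for the change of branch at the two left
corners, worth `π i` each. -/
lemma rectIntegral_inv_sub {w : ℂ} (hx₀ : x₀ < w.re) (hx₁ : w.re < x₁) (hy₀ : y₀ < w.im)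
    (hy₁ : w.im < y₁) :
    rectIntegral (fun z => (z - w)⁻¹) x₀ x₁ y₀ y₁ = 2 * Real.pi * I := by
  rw [rectIntegral, integral_inv_sub_horizontal hy₀.ne, integral_inv_sub_horizontal hy₁.ne',
    integral_inv_sub_vertical_of_gt hx₁, integral_inv_sub_vertical_of_lt hx₀]
  have h₁ := log_sub_log_neg_of_im_pos (z := x₀ + y₁ * I - w) (by simpa using hy₁)
  have h₀ := log_neg_sub_log_of_im_neg (z := x₀ + y₀ * I - w) (by simpa using hy₀)
  linear_combination h₁ + h₀

lemma rectIntegral_eq_zero_of_differentiableOn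
    (hF : DifferentiableOn ℂ F ((uIcc x₀ x₁) ×ℂ (uIcc y₀ y₁))) :
    rectIntegral F x₀ x₁ y₀ y₁ = 0 := by
  simpa [rectIntegral] using
    integral_boundary_rect_eq_zero_of_differentiableOn F (x₀ + y₀ * I) (x₁ + y₁ * I)
      (by simpa using hF)

end RectangleIntegral

/-! ### The argument principle for entire functions. -/

section ArgumentPrinciple

open Complex Set

/-- An entire function that does not vanish to infinite order at `w` is `(z - w) ^ n` times an
entire function that does not vanish at `w`. -/
lemma exists_entire_factor {f : ℂ → ℂ} (hf : Differentiable ℂ f) {w : ℂ}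
    (hw : analyticOrderAt f w ≠ ⊤) :
    ∃ g : ℂ → ℂ, Differentiable ℂ g ∧ g w ≠ 0 ∧
      ∀ z, f z = (z - w) ^ analyticOrderNatAt f w * g z := by
  obtain ⟨g₀, hg₀, hg₀w, hfg⟩ := (hf.analyticAt w).analyticOrderAt_ne_top.1 hw
  set n := analyticOrderNatAt f w
  set g : ℂ → ℂ := Function.update (fun z => f z / (z - w) ^ n) w (g₀ w) with hg
  have hne : ∀ z, z ≠ w → g z = f z / (z - w) ^ n := fun z hz => by simp [hg, hz]
  have hgw : g w = g₀ w := by simp [hg]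
  have hloc : g =ᶠ[𝓝 w] g₀ := by
    filter_upwards [hfg] with z hz
    rcases eq_or_ne z w with rfl | h
    · exact hgw
    · rw [hne z h, hz, smul_eq_mul, mul_div_cancel_left₀]
      exact pow_ne_zero _ (sub_ne_zero.2 h)
  refine ⟨g, fun z => ?_, by rwa [hgw], fun z => ?_⟩
  · rcases eq_or_ne z w with rfl | h
    · exact hg₀.differentiableAt.congr_of_eventuallyEq hloc
    · have : g =ᶠ[𝓝 z] fun z => f z / (z - w) ^ n := by
        filter_upwards [isOpen_ne.mem_nhds h] with u hu using hne u hu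
      refine DifferentiableAt.congr_of_eventuallyEq ?_ this
      exact (hf z).div (by fun_prop) (pow_ne_zero _ (sub_ne_zero.2 h))
  · rcases eq_or_ne z w with rfl | h
    · simpa [hgw] using hfg.self_of_nhds
    · rw [hne z h, mul_div_cancel₀]
      exact pow_ne_zero _ (sub_ne_zero.2 h)

lemma exists_entire_factor_finset {f : ℂ → ℂ} (hf : Differentiable ℂ f) (S : Finset ℂ)
    (hS : ∀ w ∈ S, analyticOrderAt f w ≠ ⊤) :
    ∃ g : ℂ → ℂ, Differentiable ℂ g ∧ (∀ w ∈ S, g w ≠ 0) ∧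
      ∀ z, f z = (∏ w ∈ S, (z - w) ^ analyticOrderNatAt f w) * g z := by
  classical
  induction S using Finset.induction_on with
  | empty => exact ⟨f, hf, by simp, by simp⟩
  | insert w S hw ih =>
    obtain ⟨g, hg, hgS, hfg⟩ := ih fun v hv => hS v (by simp [hv])
    set p : ℂ → ℂ := fun z => ∏ v ∈ S, (z - v) ^ analyticOrderNatAt f v with hp
    have hpd : Differentiable ℂ p := by fun_prop
    have hpw : p w ≠ 0 := Finset.prod_ne_zero_iff.2 fun v hv =>
      pow_ne_zero _ (sub_ne_zero.2 fun h => hw (h ▸ hv))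
    -- The factors already split off do not vanish at the new point, so they leave the order there
    -- unchanged.
    have hord : analyticOrderAt f w = analyticOrderAt g w := by
      have : f = p * g := funext hfg
      rw [this, analyticOrderAt_mul (hpd.analyticAt w) (hg.analyticAt w),
        (hpd.analyticAt w).analyticOrderAt_eq_zero.2 hpw, zero_add]
    obtain ⟨h, hh, hhw, hgh⟩ := exists_entire_factor hg (hord ▸ hS w (by simp))
    have hnat : analyticOrderNatAt g w = analyticOrderNatAt f w := by
      simp [analyticOrderNatAt, hord]
    refine ⟨h, hh, fun v hv => ?_, fun z => ?_⟩
    · rcases Finset.mem_insert.1 hv with rfl | hv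
      · exact hhw
      · exact right_ne_zero_of_mul (hgh v ▸ hgS v hv)
    · rw [hfg z, hgh z, Finset.prod_insert hw, hnat]
      ring

/-- The argument principle for an entire function on a rectangle. -/
theorem rectIntegral_logDeriv {f : ℂ → ℂ} (hf : Differentiable ℂ f) {x₀ x₁ y₀ y₁ : ℝ}
    (hx : x₀ ≤ x₁) (hy : y₀ ≤ y₁) (S : Finset ℂ) (hord : ∀ w ∈ S, analyticOrderAt f w ≠ ⊤)
    (hS : ∀ w ∈ S, w ∈ Ioo x₀ x₁ ×ℂ Ioo y₀ y₁)
    (hzero : ∀ w ∈ Icc x₀ x₁ ×ℂ Icc y₀ y₁, f w = 0 → w ∈ S) :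
    rectIntegral (logDeriv f) x₀ x₁ y₀ y₁ =
      2 * Real.pi * I * (∑ w ∈ S, analyticOrderNatAt f w : ℕ) := by
  obtain ⟨g, hg, hgS, hfg⟩ := exists_entire_factor_finset hf S hord
  have hg0 : ∀ w ∈ (uIcc x₀ x₁) ×ℂ (uIcc y₀ y₁), g w ≠ 0 := fun w hw h => by
    rw [uIcc_of_le hx, uIcc_of_le hy] at hw
    exact hgS w (hzero w hw (by rw [hfg, h, mul_zero])) h
  have hsub : rectBoundary x₀ x₁ y₀ y₁ ⊆ (uIcc x₀ x₁) ×ℂ (uIcc y₀ y₁) := by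
    rintro w (⟨h₁, h₂⟩ | ⟨h₁, h₂⟩)
    · refine ⟨h₁, ?_⟩
      rcases h₂ with h | h <;> rw [mem_preimage, show w.im = _ from h] <;> simp
    · refine ⟨?_, h₂⟩
      rcases h₁ with h | h <;> rw [mem_preimage, show w.re = _ from h] <;> simp
  have hbd : ∀ w ∈ rectBoundary x₀ x₁ y₀ y₁, ∀ v ∈ S, w - v ≠ 0 := by
    rintro w hw v hv h
    rw [sub_eq_zero] at h
    subst h
    obtain ⟨⟨h₁, h₂⟩, h₃, h₄⟩ := hS w hv
    rcases hw with ⟨_, h | h⟩ | ⟨h | h, _⟩ <;> simp_all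
  have hgd : DifferentiableOn ℂ (logDeriv g) ((uIcc x₀ x₁) ×ℂ (uIcc y₀ y₁)) := fun w hw =>
    ((hg.contDiff (n := 2).differentiable_deriv_two w).div (hg w) (hg0 w hw)).differentiableWithinAt
  have hterm : ∀ v ∈ S, ContinuousOn (fun w : ℂ => (analyticOrderNatAt f v : ℂ) * (w - v)⁻¹)
      (rectBoundary x₀ x₁ y₀ y₁) := fun v hv =>
    continuousOn_const.mul (ContinuousOn.inv₀ (by fun_prop) fun w hw => hbd w hw v hv)
  have heq : EqOn (logDeriv f) (fun w => (∑ v ∈ S, (analyticOrderNatAt f v : ℂ) * (w - v)⁻¹) +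
      logDeriv g w) (rectBoundary x₀ x₁ y₀ y₁) := fun w hw => by
    have h1 : f = fun z => (∏ v ∈ S, (z - v) ^ analyticOrderNatAt f v) * g z := funext hfg
    have h2 : ∀ v ∈ S, (w - v) ^ analyticOrderNatAt f v ≠ 0 := fun v hv =>
      pow_ne_zero _ (hbd w hw v hv)
    have h3 := logDeriv_mul (f := fun z => ∏ v ∈ S, (z - v) ^ analyticOrderNatAt f v) (g := g) w
      (Finset.prod_ne_zero_iff.2 h2) (hg0 w (hsub hw)) (by fun_prop) (hg w)
    have h4 := logDeriv_prod (f := fun v z => (z - v) ^ analyticOrderNatAt f v) (s := S) (x := w)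
      h2 (fun v _ => by fun_prop)
    rw [h1.symm] at h3
    rw [h3]
    congr 1
    rw [h4]
    refine Finset.sum_congr rfl fun v _ => ?_
    rw [logDeriv_fun_pow (f := fun z => z - v) (by fun_prop), logDeriv_apply]
    simp
  rw [rectIntegral_congr heq, rectIntegral_add (continuousOn_finsetSum _ hterm)
    (hgd.continuousOn.mono hsub), rectIntegral_eq_zero_of_differentiableOn hgd, add_zero,
    rectIntegral_sum _ hterm]
  push_cast
  rw [Finset.mul_sum]
  refine Finset.sum_congr rfl fun v hv => ?_
  obtain ⟨⟨h₁, h₂⟩, h₃, h₄⟩ := hS v hv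
  rw [rectIntegral_const_mul, rectIntegral_inv_sub h₁ h₂ h₃ h₄]
  ring

end ArgumentPrinciple

/-! ### The logarithmic coordinate and the behaviour at the origin. -/

namespace FractionalDelay

open Complex
open scoped ComplexConjugate

variable (D : FractionalDelay)

/-- The entire function `w ↦ Δ (exp w)`, i.e. `Δ` in the logarithmic coordinate. -/
noncomputable def logΔ (w : ℂ) : ℂ :=
  exp (D.leadingExp * w) + ∑ k : Fin D.m, (D.a k : ℂ) * exp (D.α k.castSucc * w) + D.a₀ +
    ∑ i : Fin D.N, (∑ k : Fin (D.M i), (D.b i k : ℂ) * exp (D.γ i k * w)) *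
      exp (-D.ζ i * exp (D.β i * w))

lemma leadingExp_pos : 0 < D.leadingExp := D.α_pos _

lemma α_castSucc_lt_leadingExp (k : Fin D.m) : D.α k.castSucc < D.leadingExp :=
  D.α_strictMono (Fin.castSucc_lt_last k)

lemma exp_cpow {w : ℂ} (h₁ : -Real.pi < w.im) (h₂ : w.im ≤ Real.pi) (a : ℂ) :
    exp w ^ a = exp (a * w) := by
  rw [cpow_def_of_ne_zero (exp_ne_zero w), log_exp h₁ h₂, mul_comm]

lemma logΔ_eq {w : ℂ} (h₁ : -Real.pi < w.im) (h₂ : w.im ≤ Real.pi) :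
    D.logΔ w = D.Δ (exp w) := by
  simp only [logΔ, Δ, P₀, P, exp_cpow h₁ h₂]

lemma differentiable_logΔ : Differentiable ℂ D.logΔ := by
  unfold logΔ
  fun_prop

/-- The derivative of `logΔ`. -/
noncomputable def logΔ' (w : ℂ) : ℂ :=
  D.leadingExp * exp (D.leadingExp * w) +
    ∑ k : Fin D.m, (D.a k : ℂ) * (D.α k.castSucc * exp (D.α k.castSucc * w)) +
    ∑ i : Fin D.N, ∑ k : Fin (D.M i), (D.b i k : ℂ) * (D.γ i k - D.ζ i * D.β i * exp (D.β i * w)) *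
      exp (D.γ i k * w) * exp (-D.ζ i * exp (D.β i * w))

lemma hasDerivAt_exp_const_mul (c w : ℂ) :
    HasDerivAt (fun w => exp (c * w)) (c * exp (c * w)) w := by
  simpa [mul_comm] using ((hasDerivAt_id w).const_mul c).cexp

lemma deriv_logΔ (w : ℂ) : deriv D.logΔ w = D.logΔ' w := by
  have h1 := hasDerivAt_exp_const_mul D.leadingExp w
  have h2 : HasDerivAt (fun w => ∑ k : Fin D.m, (D.a k : ℂ) * exp (D.α k.castSucc * w))
      (∑ k : Fin D.m, (D.a k : ℂ) * (D.α k.castSucc * exp (D.α k.castSucc * w))) w :=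
    HasDerivAt.fun_sum fun k _ => (hasDerivAt_exp_const_mul _ w).const_mul _
  have h3 : HasDerivAt (fun w => ∑ i : Fin D.N,
      (∑ k : Fin (D.M i), (D.b i k : ℂ) * exp (D.γ i k * w)) * exp (-D.ζ i * exp (D.β i * w)))
      (∑ i : Fin D.N, ∑ k : Fin (D.M i), (D.b i k : ℂ) *
        (D.γ i k - D.ζ i * D.β i * exp (D.β i * w)) *
        exp (D.γ i k * w) * exp (-D.ζ i * exp (D.β i * w))) w := by
    refine HasDerivAt.fun_sum fun i _ => ?_
    have h4 : HasDerivAt (fun w => ∑ k : Fin (D.M i), (D.b i k : ℂ) * exp (D.γ i k * w))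
        (∑ k : Fin (D.M i), (D.b i k : ℂ) * (D.γ i k * exp (D.γ i k * w))) w :=
      HasDerivAt.fun_sum fun k _ => (hasDerivAt_exp_const_mul _ w).const_mul _
    have h5 := ((hasDerivAt_exp_const_mul (D.β i) w).const_mul (-D.ζ i : ℂ)).cexp
    refine (h4.mul h5).congr_deriv ?_
    rw [Finset.sum_mul, Finset.sum_mul, ← Finset.sum_add_distrib]
    refine Finset.sum_congr rfl fun k _ => ?_
    ring
  exact (((h1.add h2).add_const _).add h3).deriv

lemma logΔ_conj (w : ℂ) : D.logΔ (conj w) = conj (D.logΔ w) := by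
  simp only [logΔ, map_add, map_sum, map_mul, ← exp_conj, map_neg, conj_ofReal]

lemma logDeriv_logΔ_conj (w : ℂ) : logDeriv D.logΔ (conj w) = conj (logDeriv D.logΔ w) := by
  simp only [logDeriv_apply, deriv_logΔ, logΔ_conj, map_div₀]
  congr 1
  simp only [logΔ', map_add, map_sum, map_mul, ← exp_conj, map_neg, map_sub, conj_ofReal]

lemma differentiableAt_Δ {s : ℂ} (hs : s ∈ slitPlane) : DifferentiableAt ℂ D.Δ s := by
  have h : ∀ c : ℂ, DifferentiableAt ℂ (fun z : ℂ => z ^ c) s := fun c =>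
    differentiableAt_id.cpow_const hs
  unfold Δ P₀ P
  fun_prop

lemma analyticAt_Δ {s : ℂ} (hs : s ∈ slitPlane) : AnalyticAt ℂ D.Δ s :=
  DifferentiableOn.analyticAt (fun _ hz => (D.differentiableAt_Δ hz).differentiableWithinAt)
    (isOpen_slitPlane.mem_nhds hs)

lemma exp_mem_slitPlane_of_abs_im_lt {w : ℂ} (hw : |w.im| < Real.pi) : exp w ∈ slitPlane := by
  obtain ⟨h₁, h₂⟩ := abs_lt.1 hw
  rw [mem_slitPlane_iff_arg, ← log_im, log_exp h₁ h₂.le]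
  exact ⟨h₂.ne, exp_ne_zero w⟩

lemma logΔ_eventuallyEq {w : ℂ} (hw : |w.im| < Real.pi) : D.logΔ =ᶠ[𝓝 w] D.Δ ∘ exp := by
  have : IsOpen {w : ℂ | |w.im| < Real.pi} := isOpen_lt (by fun_prop) continuous_const
  filter_upwards [this.mem_nhds hw] with z hz
  exact D.logΔ_eq (abs_lt.1 hz).1 (abs_lt.1 hz).2.le

lemma logDeriv_logΔ {w : ℂ} (hw : |w.im| < Real.pi) :
    logDeriv D.logΔ w = exp w * deriv D.Δ (exp w) / D.Δ (exp w) := by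
  rw [(logDeriv_congr_nhds (D.logΔ_eventuallyEq hw)).self_of_nhds,
    logDeriv_comp (D.differentiableAt_Δ (exp_mem_slitPlane_of_abs_im_lt hw)) (by fun_prop),
    logDeriv_apply, Complex.deriv_exp]
  ring

lemma analyticOrderNatAt_logΔ {w : ℂ} (hw : |w.im| < Real.pi) :
    analyticOrderNatAt D.logΔ w = analyticOrderNatAt D.Δ (exp w) := by
  rw [analyticOrderNatAt, analyticOrderNatAt, analyticOrderAt_congr (D.logΔ_eventuallyEq hw),
    analyticOrderAt_comp_of_deriv_ne_zero (by fun_prop) (by simp)]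

/-- Writing the limit as `0 ^ a` covers `a = 0` (value 1) and `a > 0` (value 0) at once, so that the
limit of `logΔ` is literally `Δ 0`. The filter leaves `im w` free, which makes the convergence
uniform along vertical segments. -/
lemma tendsto_exp_mul_comap_re_atBot {a : ℝ} (ha : 0 ≤ a) :
    Tendsto (fun w => exp (a * w)) (comap re atBot) (𝓝 (0 ^ (a : ℂ))) := by
  rcases ha.eq_or_lt with rfl | ha
  · simpa using tendsto_const_nhds
  · rw [zero_cpow (by exact_mod_cast ha.ne')]
    refine tendsto_exp_comap_re_atBot.comp (tendsto_comap_iff.2 ?_)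
    have : re ∘ (fun w : ℂ => (a : ℂ) * w) = fun w => a * w.re := by
      ext w; simp
    rw [this]
    exact tendsto_comap.const_mul_atBot ha

lemma tendsto_logΔ_comap_re_atBot : Tendsto D.logΔ (comap re atBot) (𝓝 (D.Δ 0)) := by
  unfold Δ logΔ P₀ P
  refine (((tendsto_exp_mul_comap_re_atBot D.leadingExp_pos.le).add
    (tendsto_finsetSum _ fun k _ => (tendsto_exp_mul_comap_re_atBot
      (D.α_pos _).le).const_mul _)).add_const _).add
    (tendsto_finsetSum _ fun i _ => (tendsto_finsetSum _ fun k _ =>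
      (tendsto_exp_mul_comap_re_atBot (D.γ_nonneg i k)).const_mul _).mul
      ((tendsto_exp_mul_comap_re_atBot (D.β_pos i).le).const_mul _).cexp)

lemma tendsto_logΔ'_comap_re_atBot : Tendsto D.logΔ' (comap re atBot) (𝓝 0) := by
  have h0 : ∀ {a : ℝ}, 0 < a → Tendsto (fun w => exp (a * w)) (comap re atBot) (𝓝 0) :=
    fun {a} ha => by
      simpa [zero_cpow (show (a : ℂ) ≠ 0 by exact_mod_cast ha.ne')] using
        tendsto_exp_mul_comap_re_atBot ha.le
  have h1 := (h0 D.leadingExp_pos).const_mul (D.leadingExp : ℂ)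
  have h2 : Tendsto (fun w => ∑ k : Fin D.m, (D.a k : ℂ) *
      (D.α k.castSucc * exp (D.α k.castSucc * w))) (comap re atBot) (𝓝 (∑ k : Fin D.m, 0)) :=
    tendsto_finsetSum _ fun k _ => by
      simpa using ((h0 (D.α_pos k.castSucc)).const_mul (D.α k.castSucc : ℂ)).const_mul (D.a k : ℂ)
  have h3 : Tendsto (fun w => ∑ i : Fin D.N, ∑ k : Fin (D.M i), (D.b i k : ℂ) *
        (D.γ i k - D.ζ i * D.β i * exp (D.β i * w)) *
        exp (D.γ i k * w) * exp (-D.ζ i * exp (D.β i * w))) (comap re atBot)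
      (𝓝 (∑ i : Fin D.N, ∑ k : Fin (D.M i), 0)) := by
    refine tendsto_finsetSum _ fun i _ => tendsto_finsetSum _ fun k _ => ?_
    have h4 := (h0 (D.β_pos i)).const_mul (D.ζ i * D.β i : ℂ)
    have h5 := ((h0 (D.β_pos i)).const_mul (-D.ζ i : ℂ)).cexp
    have h6 := tendsto_exp_mul_comap_re_atBot (D.γ_nonneg i k)
    have h7 := (((h4.const_sub (D.γ i k : ℂ)).const_mul (D.b i k : ℂ)).mul h6).mul h5
    convert h7 using 2
    -- The limit contains `γ * 0 ^ γ`, which vanishes in both cases: through `γ` if `γ = 0`, through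
    -- the power otherwise.
    rcases (D.γ_nonneg i k).eq_or_lt with h | h
    · simp [← h]
    · simp [zero_cpow (show (D.γ i k : ℂ) ≠ 0 by exact_mod_cast h.ne')]
  unfold logΔ'
  simpa using (h1.add h2).add h3

variable {D}

/-- Along the positive real axis both the assumed limit and `Δ 0` are limits of `Δ`, so they agree.
-/
lemma NonzeroAtOrigin.Δ_zero_ne (h : D.NonzeroAtOrigin) : D.Δ 0 ≠ 0 := by
  obtain ⟨c, hc, hlim⟩ := h
  have h1 : Tendsto (fun x : ℝ => (x : ℂ)) atBot (comap re atBot) := by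
    rw [tendsto_comap_iff]
    exact tendsto_id
  have h2 : Tendsto (fun x : ℝ => exp (x : ℂ)) atBot (𝓝[{s | 0 ≤ s.re} \ {0}] 0) := by
    refine tendsto_nhdsWithin_iff.2 ⟨tendsto_exp_comap_re_atBot.comp h1, .of_forall fun x => ?_⟩
    exact ⟨by simpa [exp_ofReal_re] using (Real.exp_pos x).le, by simp⟩
  have h3 := D.tendsto_logΔ_comap_re_atBot.comp h1
  have h4 : D.logΔ ∘ (fun x : ℝ => (x : ℂ)) = D.Δ ∘ (fun x : ℝ => exp (x : ℂ)) := by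
    ext x
    exact D.logΔ_eq (by simpa using Real.pi_pos) (by simpa using Real.pi_pos.le)
  rw [h4] at h3
  rwa [tendsto_nhds_unique h3 (hlim.comp h2)]

lemma NonzeroAtOrigin.tendsto_logDeriv_logΔ (h : D.NonzeroAtOrigin) :
    Tendsto (logDeriv D.logΔ) (comap re atBot) (𝓝 0) := by
  have := D.tendsto_logΔ'_comap_re_atBot.div D.tendsto_logΔ_comap_re_atBot h.Δ_zero_ne
  simp only [zero_div] at this
  refine this.congr fun w => ?_
  simp [logDeriv_apply, deriv_logΔ]

end FractionalDelay

/-! ### Poles of the logarithmic derivative. -/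

section LogDerivNearZero

open Complex Set

lemma tendsto_sub_mul_logDeriv {f : ℂ → ℂ} (hf : Differentiable ℂ f) {w : ℂ}
    (hw : analyticOrderAt f w ≠ ⊤) :
    Tendsto (fun z => (z - w) * logDeriv f z) (𝓝[≠] w) (𝓝 (analyticOrderNatAt f w)) := by
  obtain ⟨g, hg, hgw, hfg⟩ := exists_entire_factor hf hw
  have hcont : ContinuousAt (fun z => (analyticOrderNatAt f w : ℂ) + (z - w) * logDeriv g z) w := by
    have : ContinuousAt (logDeriv g) w :=
      ((hg.contDiff (n := 2).differentiable_deriv_two w).div (hg w) hgw).continuousAt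
    fun_prop
  have hlim := hcont.tendsto.mono_left (nhdsWithin_le_nhds (s := {w}ᶜ))
  simp only [sub_self, zero_mul, add_zero] at hlim
  refine hlim.congr' ?_
  filter_upwards [self_mem_nhdsWithin, nhdsWithin_le_nhds (hg.continuous.continuousAt.eventually_ne
    hgw)] with z hz hgz
  have hzw : z - w ≠ 0 := sub_ne_zero.2 hz
  have h1 : f = fun z => (z - w) ^ analyticOrderNatAt f w * g z := funext hfg
  have h2 := logDeriv_mul (f := fun z => (z - w) ^ analyticOrderNatAt f w) (g := g) z
    (pow_ne_zero _ hzw) hgz (by fun_prop) (hg z)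
  rw [← h1, logDeriv_fun_pow (f := fun z => z - w) (by fun_prop)] at h2
  rw [h2, logDeriv_apply (fun z => z - w)]
  simp
  field_simp

/-- At a zero of order `n ≥ 1` the logarithmic derivative has a simple pole of residue `n`, so along
the line it dominates a multiple of `1 / (y - im w)`. Since `n > 1/2`, the constant 2 suffices. -/
lemma not_intervalIntegrable_logDeriv_vertical {f : ℂ → ℂ} (hf : Differentiable ℂ f) {w : ℂ}
    (hw : analyticOrderAt f w ≠ ⊤) (hfw : f w = 0) {y₀ y₁ : ℝ} (hy : y₀ ≠ y₁)
    (him : w.im ∈ uIcc y₀ y₁) :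
    ¬ IntervalIntegrable (fun y : ℝ => logDeriv f (w.re + y * I)) volume y₀ y₁ := by
  refine not_intervalIntegrable_of_sub_inv_isBigO_punctured (c := w.im) ?_ hy him
  have hn : 1 ≤ analyticOrderNatAt f w := by
    rw [Nat.one_le_iff_ne_zero]
    intro h
    have : analyticOrderAt f w = 0 := by rw [← Nat.cast_analyticOrderNatAt hw, h]; rfl
    exact (hf.analyticAt w).analyticOrderAt_eq_zero.1 this hfw
  have hline : Tendsto (fun y : ℝ => (w.re + y * I : ℂ)) (𝓝[≠] w.im) (𝓝[≠] w) := by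
    refine tendsto_nhdsWithin_iff.2 ⟨?_, ?_⟩
    · have : Continuous (fun y : ℝ => (w.re + y * I : ℂ)) := by fun_prop
      simpa [re_add_im] using (this.tendsto w.im).mono_left nhdsWithin_le_nhds
    · filter_upwards [self_mem_nhdsWithin] with y hy h
      exact hy (by simpa using congrArg im h)
  have hlim := ((tendsto_sub_mul_logDeriv hf hw).comp hline).norm
  have hhalf : (1 / 2 : ℝ) < ‖(analyticOrderNatAt f w : ℂ)‖ := by
    rw [norm_natCast]
    have : (1 : ℝ) ≤ analyticOrderNatAt f w := by exact_mod_cast hn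
    linarith
  refine Asymptotics.IsBigO.of_bound 2 ?_
  filter_upwards [hlim.eventually_const_lt hhalf, self_mem_nhdsWithin] with y h hy
  have hy' : 0 < |y - w.im| := abs_pos.2 (sub_ne_zero.2 hy)
  have hsub : (w.re + y * I : ℂ) - w = (y - w.im : ℝ) * I := by
    apply Complex.ext <;> simp
  simp only [Function.comp_apply, hsub, norm_mul, norm_real, norm_I, mul_one, Real.norm_eq_abs]
    at h
  rw [norm_inv, Real.norm_eq_abs, inv_le_iff_one_le_mul₀ hy']
  linarith

lemma finite_zeros_of_isCompact {f : ℂ → ℂ} (hf : Differentiable ℂ f) (hne : ∃ z, f z ≠ 0)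
    {K : Set ℂ} (hK : IsCompact K) : {w ∈ K | f w = 0}.Finite := by
  obtain ⟨z, hz⟩ := hne
  have h := AnalyticOnNhd.preimage_zero_mem_codiscrete (fun w _ => hf.analyticAt w) hz
  refine (hK.finite_sdiff_of_mem_codiscreteWithin
    (codiscreteWithin_mono (subset_univ K) h)).subset fun w hw => ⟨hw.1, by simpa using hw.2⟩

end LogDerivNearZero

/-! ### Part (a): limits of the four edges and the root count. -/

namespace FractionalDelay

open Complex Set
open scoped ComplexConjugate

variable {D : FractionalDelay}

lemma ofReal_exp_mul_exp (x θ : ℝ) :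
    ((Real.exp x : ℝ) : ℂ) * exp (θ * I) = exp (x + θ * I) := by
  rw [ofReal_exp, ← Complex.exp_add]

lemma abs_lt_pi_of_mem_Icc {θ : ℝ} (hθ : θ ∈ Icc (-(Real.pi / 2)) (Real.pi / 2)) :
    |θ| < Real.pi := by
  rw [abs_lt]
  constructor <;> linarith [hθ.1, hθ.2, Real.pi_pos]

/-- The integral over the large arc in the logarithmic coordinate. -/
lemma lintegral_arc_exp (x : ℝ) :
    ∫⁻ θ in Icc (-(Real.pi / 2)) (Real.pi / 2),
      ‖((Real.exp x : ℝ) * exp (θ * I)) * deriv D.Δ ((Real.exp x : ℝ) * exp (θ * I)) /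
          D.Δ ((Real.exp x : ℝ) * exp (θ * I)) - (D.leadingExp : ℂ)‖ₑ =
    ∫⁻ θ in Icc (-(Real.pi / 2)) (Real.pi / 2),
      ‖logDeriv D.logΔ (x + θ * I) - (D.leadingExp : ℂ)‖ₑ := by
  refine setLIntegral_congr_fun measurableSet_Icc fun θ hθ => ?_
  rw [ofReal_exp_mul_exp, logDeriv_logΔ _ (by simpa using abs_lt_pi_of_mem_Icc hθ)]

lemma largeArcLimit_iff : D.LargeArcLimit ↔
    Tendsto (fun x : ℝ => ∫⁻ θ in Icc (-(Real.pi / 2)) (Real.pi / 2),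
      ‖logDeriv D.logΔ (x + θ * I) - (D.leadingExp : ℂ)‖ₑ) atTop (𝓝 0) := by
  refine ⟨fun h => ?_, fun h => ?_⟩
  · exact (h.comp Real.tendsto_exp_atTop).congr fun x => lintegral_arc_exp x
  · refine (h.comp Real.tendsto_log_atTop).congr' ?_
    filter_upwards [eventually_gt_atTop 0] with R hR
    simp only [Function.comp_apply]
    rw [← lintegral_arc_exp, Real.exp_log hR]

lemma measurable_logDeriv_vertical (x : ℝ) :
    Measurable fun θ : ℝ => logDeriv D.logΔ (x + θ * I) := by
  have h : Measurable (logDeriv D.logΔ) :=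
    (measurable_deriv _).div D.differentiable_logΔ.continuous.measurable
  exact h.comp (by fun_prop)

lemma LargeArcLimit.eventually_integrableOn (h : D.LargeArcLimit) :
    ∀ᶠ x : ℝ in atTop, IntegrableOn (fun θ : ℝ => logDeriv D.logΔ (x + θ * I) - D.leadingExp)
      (Icc (-(Real.pi / 2)) (Real.pi / 2)) := by
  filter_upwards [(largeArcLimit_iff.1 h).eventually_lt_const ENNReal.zero_lt_top] with x hx
  exact ⟨((measurable_logDeriv_vertical x).sub_const _).aestronglyMeasurable, hx⟩

lemma LargeArcLimit.eventually_intervalIntegrable (h : D.LargeArcLimit) :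
    ∀ᶠ x : ℝ in atTop, IntervalIntegrable (fun θ : ℝ => logDeriv D.logΔ (x + θ * I)) volume
      (-(Real.pi / 2)) (Real.pi / 2) := by
  filter_upwards [h.eventually_integrableOn] with x hx
  have h1 : IntervalIntegrable (fun θ : ℝ => logDeriv D.logΔ (x + θ * I) - D.leadingExp) volume
      (-(Real.pi / 2)) (Real.pi / 2) := by
    rw [intervalIntegrable_iff_integrableOn_Icc_of_le (by linarith [Real.pi_pos])]
    exact hx
  simpa using h1.add (intervalIntegrable_const (c := (D.leadingExp : ℂ)))

lemma LargeArcLimit.tendsto_integral (h : D.LargeArcLimit) :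
    Tendsto (fun x : ℝ => ∫ θ in (-(Real.pi / 2))..(Real.pi / 2), logDeriv D.logΔ (x + θ * I))
      atTop (𝓝 (Real.pi * D.leadingExp)) := by
  rw [← tendsto_sub_nhds_zero_iff, tendsto_zero_iff_enorm_tendsto_zero]
  refine tendsto_of_tendsto_of_tendsto_of_le_of_le' tendsto_const_nhds (largeArcLimit_iff.1 h)
    (.of_forall fun _ => zero_le) ?_
  filter_upwards [h.eventually_intervalIntegrable] with x hx
  have h1 : (∫ θ in (-(Real.pi / 2))..(Real.pi / 2), logDeriv D.logΔ (x + θ * I)) -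
      Real.pi * D.leadingExp =
      ∫ θ in Icc (-(Real.pi / 2)) (Real.pi / 2), (logDeriv D.logΔ (x + θ * I) - D.leadingExp) := by
    rw [integral_Icc_eq_integral_Ioc, ← intervalIntegral.integral_of_le
      (by linarith [Real.pi_pos]), intervalIntegral.integral_sub hx (by simp),
      intervalIntegral.integral_const, sub_neg_eq_add, add_halves, real_smul]
  rw [h1]
  exact enorm_integral_le_lintegral_enorm _

lemma NonzeroAtOrigin.tendsto_integral (h : D.NonzeroAtOrigin) :
    Tendsto (fun x : ℝ => ∫ θ in (-(Real.pi / 2))..(Real.pi / 2), logDeriv D.logΔ (x + θ * I))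
      atBot (𝓝 0) := by
  rw [Metric.tendsto_nhds]
  intro ε hε
  -- The segment has length `π`, so this bound yields `ε / 2 < ε`.
  have hε' : 0 < ε / (2 * Real.pi) := by positivity
  have h1 := (Metric.tendsto_nhds.1 h.tendsto_logDeriv_logΔ) _ hε'
  rw [eventually_comap] at h1
  filter_upwards [h1] with x hx
  rw [dist_zero_right]
  refine (intervalIntegral.norm_integral_le_of_norm_le_const (C := ε / (2 * Real.pi))
    fun θ _ => ?_).trans_lt ?_
  · simpa using (hx (x + θ * I) (by simp)).le
  · rw [sub_neg_eq_add, add_halves, abs_of_pos Real.pi_pos]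
    field_simp
    linarith

lemma NonzeroAtOrigin.exists_forall_re_le (h : D.NonzeroAtOrigin) :
    ∃ X : ℝ, ∀ w : ℂ, w.re ≤ X → D.logΔ w ≠ 0 := by
  have h1 := D.tendsto_logΔ_comap_re_atBot.eventually_ne h.Δ_zero_ne
  rw [eventually_comap, eventually_atBot] at h1
  obtain ⟨X, hX⟩ := h1
  exact ⟨X, fun w hw => hX _ hw w rfl⟩

lemma NonzeroAtOrigin.analyticOrderAt_ne_top (h : D.NonzeroAtOrigin) (w : ℂ) :
    analyticOrderAt D.logΔ w ≠ ⊤ := by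
  obtain ⟨X, hX⟩ := h.exists_forall_re_le
  rw [Ne, AnalyticOnNhd.analyticOrderAt_eq_top_iff_eq_zero w
    fun z => D.differentiable_logΔ.analyticAt z]
  intro h0
  exact hX X (by simp) (by simp [h0])

/-- Arcs with a finite integral contain no zero, by `not_intervalIntegrable_logDeriv_vertical`. This
bounds the roots with no growth estimate on `Δ`. -/
lemma LargeArcLimit.exists_forall_le_re (h : D.LargeArcLimit) (h₀ : D.NonzeroAtOrigin) :
    ∃ X : ℝ, ∀ w : ℂ, X ≤ w.re → w.im ∈ Icc (-(Real.pi / 2)) (Real.pi / 2) →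
      D.logΔ w ≠ 0 := by
  obtain ⟨X, hX⟩ := eventually_atTop.1 h.eventually_intervalIntegrable
  refine ⟨X, fun w hw him h0 => ?_⟩
  refine not_intervalIntegrable_logDeriv_vertical D.differentiable_logΔ
    (h₀.analyticOrderAt_ne_top w) h0 (by linarith [Real.pi_pos]) ?_ (hX w.re hw)
  rwa [uIcc_of_le (by linarith [Real.pi_pos])]

lemma exp_add_pi_div_two_mul_I (x : ℝ) :
    exp (x + (Real.pi / 2 : ℝ) * I) = (Real.exp x : ℝ) * I := by
  rw [Complex.exp_add, ofReal_exp]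
  push_cast
  rw [exp_pi_div_two_mul_I]

lemma conj_add_mul_I (x θ : ℝ) : conj (x + θ * I : ℂ) = x + (-θ : ℝ) * I := by
  simp

lemma logΔ_ne_zero_of_im_eq (hne : ∀ ω : ℝ, ω ≠ 0 → D.Δ (ω * I) ≠ 0) (x : ℝ) :
    D.logΔ (x + (Real.pi / 2 : ℝ) * I) ≠ 0 ∧ D.logΔ (x + (-(Real.pi / 2) : ℝ) * I) ≠ 0 := by
  have h1 : D.logΔ (x + (Real.pi / 2 : ℝ) * I) ≠ 0 := by
    rw [logΔ_eq, exp_add_pi_div_two_mul_I]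
    · exact hne _ (Real.exp_pos x).ne'
    · simp; linarith [Real.pi_pos]
    · simp; linarith [Real.pi_pos]
  refine ⟨h1, ?_⟩
  rw [← conj_add_mul_I, logΔ_conj]
  simpa using h1

/-- The zeros of `logΔ` in the closed strip `|im w| ≤ π / 2`. -/
def stripZeros (D : FractionalDelay) : Set ℂ :=
  {w | w.im ∈ Icc (-(Real.pi / 2)) (Real.pi / 2) ∧ D.logΔ w = 0}

lemma injOn_exp_strip : InjOn exp {w : ℂ | w.im ∈ Icc (-(Real.pi / 2)) (Real.pi / 2)} := by
  intro w hw z hz h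
  have h1 := abs_lt.1 (abs_lt_pi_of_mem_Icc hw)
  have h2 := abs_lt.1 (abs_lt_pi_of_mem_Icc hz)
  exact exp_inj_of_neg_pi_lt_of_le_pi h1.1 h1.2.le h2.1 h2.2.le h

lemma unstableRoots_eq (h : D.NonzeroAtOrigin) : D.unstableRoots = exp '' D.stripZeros := by
  ext s
  constructor
  · rintro ⟨hre, hs⟩
    have hs0 : s ≠ 0 := by
      rintro rfl
      exact h.Δ_zero_ne hs
    have him : (log s).im ∈ Icc (-(Real.pi / 2)) (Real.pi / 2) := by
      rw [log_im]
      exact abs_le.1 (abs_arg_le_pi_div_two_iff.2 hre)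
    refine ⟨log s, ⟨him, ?_⟩, exp_log hs0⟩
    rw [logΔ_eq _ (neg_pi_lt_log_im s) (log_im_le_pi s), exp_log hs0, hs]
  · rintro ⟨w, ⟨him, hw⟩, rfl⟩
    have h1 := abs_lt.1 (abs_lt_pi_of_mem_Icc him)
    rw [logΔ_eq _ h1.1 h1.2.le] at hw
    refine ⟨?_, hw⟩
    rw [exp_re]
    exact mul_nonneg (Real.exp_pos _).le (Real.cos_nonneg_of_mem_Icc him)

lemma numUnstableRoots_eq (h : D.NonzeroAtOrigin) (hfin : D.stripZeros.Finite) :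
    D.numUnstableRoots = ∑ w ∈ hfin.toFinset, analyticOrderNatAt D.logΔ w := by
  rw [numUnstableRoots, unstableRoots_eq h,
    finsum_mem_image (injOn_exp_strip.mono fun w hw => hw.1), finsum_mem_eq_finite_toFinset_sum _ hfin]
  refine Finset.sum_congr rfl fun w hw => ?_
  exact (D.analyticOrderNatAt_logΔ (abs_lt_pi_of_mem_Icc ((hfin.mem_toFinset.1 hw).1))).symm

lemma continuousAt_logDeriv_logΔ {w : ℂ} (hw : D.logΔ w ≠ 0) :
    ContinuousAt (logDeriv D.logΔ) w :=
  ((D.differentiable_logΔ.contDiff (n := 2).differentiable_deriv_two w).div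
    (D.differentiable_logΔ w) hw).continuousAt

/-- The imaginary-axis integral in the logarithmic coordinate. -/
lemma integral_re_logDeriv_eq (hne : ∀ ω : ℝ, ω ≠ 0 → D.Δ (ω * I) ≠ 0) (x₀ x₁ : ℝ) :
    ∫ ω in Real.exp x₀..Real.exp x₁, (deriv D.Δ (ω * I) / D.Δ (ω * I)).re =
      (∫ x : ℝ in x₀..x₁, logDeriv D.logΔ (x + (Real.pi / 2 : ℝ) * I)).im := by
  have hcont : Continuous fun x : ℝ => logDeriv D.logΔ (x + (Real.pi / 2 : ℝ) * I) :=
    continuous_iff_continuousAt.2 fun x =>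
      (continuousAt_logDeriv_logΔ (logΔ_ne_zero_of_im_eq hne x).1).comp
        (f := fun x : ℝ => (x + (Real.pi / 2 : ℝ) * I : ℂ)) (by fun_prop)
  have him := imCLM.intervalIntegral_comp_comm (hcont.intervalIntegrable (μ := volume) x₀ x₁)
  simp only [imCLM_apply] at him
  rw [← him, ← intervalIntegral.integral_comp_mul_deriv' (f := Real.exp) (f' := Real.exp)
    (g := fun ω : ℝ => (deriv D.Δ (ω * I) / D.Δ (ω * I)).re)
    (fun x _ => Real.hasDerivAt_exp x) Real.continuous_exp.continuousOn]
  · refine intervalIntegral.integral_congr fun x _ => ?_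
    have hpi : |(x + (Real.pi / 2 : ℝ) * I : ℂ).im| < Real.pi := by
      simpa using abs_lt_pi_of_mem_Icc (θ := Real.pi / 2) ⟨by linarith [Real.pi_pos], le_rfl⟩
    simp only [Function.comp_apply]
    rw [logDeriv_logΔ _ hpi, exp_add_pi_div_two_mul_I, mul_assoc, mul_div_assoc, im_ofReal_mul,
      mul_div_assoc, I_mul_im, mul_comm]
  · rintro _ ⟨x, _, rfl⟩
    have hω := Real.exp_pos x
    have hs : (Real.exp x : ℂ) * I ∈ slitPlane := by
      right; simp [exp_ofReal_re]
    have h1 : ContinuousAt (fun s => deriv D.Δ s / D.Δ s) ((Real.exp x : ℂ) * I) :=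
      (D.analyticAt_Δ hs).deriv.continuousAt.div (D.differentiableAt_Δ hs).continuousAt
        (hne _ hω.ne')
    exact (continuous_re.continuousAt.comp (h1.comp (f := fun ω : ℝ => (ω : ℂ) * I)
      (by fun_prop))).continuousWithinAt


lemma rectIntegral_logDeriv_logΔ_im (hne : ∀ ω : ℝ, ω ≠ 0 → D.Δ (ω * I) ≠ 0) (x₀ x₁ : ℝ) :
    (rectIntegral (logDeriv D.logΔ) x₀ x₁ (-(Real.pi / 2)) (Real.pi / 2)).im =
      (∫ θ in (-(Real.pi / 2))..(Real.pi / 2), logDeriv D.logΔ (x₁ + θ * I)).re -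
      (∫ θ in (-(Real.pi / 2))..(Real.pi / 2), logDeriv D.logΔ (x₀ + θ * I)).re -
      2 * ∫ ω in Real.exp x₀..Real.exp x₁, (deriv D.Δ (ω * I) / D.Δ (ω * I)).re := by
  have hconj : ∫ x : ℝ in x₀..x₁, logDeriv D.logΔ (x + (-(Real.pi / 2) : ℝ) * I) =
      conj (∫ x : ℝ in x₀..x₁, logDeriv D.logΔ (x + (Real.pi / 2 : ℝ) * I)) := by
    simp only [← conj_add_mul_I, logDeriv_logΔ_conj, intervalIntegral, integral_conj, map_sub]
  rw [integral_re_logDeriv_eq hne, rectIntegral, hconj]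
  simp only [sub_im, add_im, conj_im, I_mul_im]
  ring

theorem argument_principle_of_largeArcLimit (h₀ : D.NonzeroAtOrigin)
    (hne : ∀ ω : ℝ, ω ≠ 0 → D.Δ (ω * I) ≠ 0) (h : D.LargeArcLimit) :
    D.unstableRoots.Finite ∧
      Tendsto (fun p : ℝ × ℝ => ∫ ω in p.1..p.2, (deriv D.Δ (ω * I) / D.Δ (ω * I)).re)
        (𝓝[>] (0 : ℝ) ×ˢ atTop)
        (𝓝 (Real.pi * D.leadingExp / 2 - Real.pi * D.numUnstableRoots)) := by
  obtain ⟨X₀, hX₀⟩ := h₀.exists_forall_re_le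
  obtain ⟨X₁, hX₁⟩ := h.exists_forall_le_re h₀
  have hre : ∀ w ∈ D.stripZeros, X₀ < w.re ∧ w.re < X₁ := fun w hw =>
    ⟨not_le.1 fun hle => hX₀ w hle hw.2, not_le.1 fun hle => hX₁ w hle hw.1 hw.2⟩
  -- The horizontal edges correspond to the imaginary axis, where roots are excluded by assumption.
  have him : ∀ w ∈ D.stripZeros, w.im ∈ Ioo (-(Real.pi / 2)) (Real.pi / 2) := by
    rintro w ⟨⟨h1, h2⟩, hw⟩
    have hb := logΔ_ne_zero_of_im_eq hne w.re
    refine ⟨h1.lt_of_ne fun heq => hb.2 ?_, h2.lt_of_ne fun heq => hb.1 ?_⟩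
    · rwa [heq, re_add_im]
    · rwa [← heq, re_add_im]
  have hfin : D.stripZeros.Finite := by
    refine (finite_zeros_of_isCompact D.differentiable_logΔ ⟨X₀, hX₀ X₀ (by simp)⟩
      (isCompact_Icc.reProdIm isCompact_Icc :
        IsCompact (Icc X₀ X₁ ×ℂ Icc (-(Real.pi / 2)) (Real.pi / 2)))).subset fun w hw => ?_
    exact ⟨⟨⟨(hre w hw).1.le, (hre w hw).2.le⟩, hw.1⟩, hw.2⟩
  refine ⟨by rw [unstableRoots_eq h₀]; exact hfin.image _, ?_⟩
  -- Such rectangles contain every zero in their interior. The maximum also secures `x₀ ≤ x₁`, since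
  -- without zeros `X₁` may lie left of `X₀`.
  have key : ∀ x₀ x₁ : ℝ, x₀ ≤ X₀ → max X₀ X₁ ≤ x₁ →
      ∫ ω in Real.exp x₀..Real.exp x₁, (deriv D.Δ (ω * I) / D.Δ (ω * I)).re =
      ((∫ θ in (-(Real.pi / 2))..(Real.pi / 2), logDeriv D.logΔ (x₁ + θ * I)).re -
        (∫ θ in (-(Real.pi / 2))..(Real.pi / 2), logDeriv D.logΔ (x₀ + θ * I)).re) / 2 -
        Real.pi * D.numUnstableRoots := by
    intro x₀ x₁ h0 h1
    have hA := rectIntegral_logDeriv D.differentiable_logΔ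
      (h0.trans ((le_max_left _ _).trans h1))
      (show -(Real.pi / 2) ≤ Real.pi / 2 by linarith [Real.pi_pos]) hfin.toFinset
      (fun w _ => h₀.analyticOrderAt_ne_top w)
      (fun w hw => by
        rw [hfin.mem_toFinset] at hw
        exact ⟨⟨h0.trans_lt (hre w hw).1, (hre w hw).2.trans_le ((le_max_right _ _).trans h1)⟩,
          him w hw⟩)
      (fun w hw hw0 => hfin.mem_toFinset.2 ⟨hw.2, hw0⟩)
    rw [← numUnstableRoots_eq h₀ hfin] at hA
    have hB := congrArg im hA
    rw [rectIntegral_logDeriv_logΔ_im hne] at hB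
    have hC : (2 * Real.pi * I * (D.numUnstableRoots : ℂ)).im =
        2 * Real.pi * D.numUnstableRoots := by
      simp
    rw [hC] at hB
    linarith
  have hlog₀ : Tendsto (fun p : ℝ × ℝ => Real.log p.1) (𝓝[>] (0 : ℝ) ×ˢ atTop) atBot :=
    Real.tendsto_log_nhdsGT_zero.comp tendsto_fst
  have hlog₁ : Tendsto (fun p : ℝ × ℝ => Real.log p.2) (𝓝[>] (0 : ℝ) ×ˢ atTop) atTop :=
    Real.tendsto_log_atTop.comp tendsto_snd
  have hlim := ((((continuous_re.tendsto _).comp (h.tendsto_integral.comp hlog₁)).sub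
    ((continuous_re.tendsto _).comp (h₀.tendsto_integral.comp hlog₀))).div_const 2).sub_const
    (Real.pi * D.numUnstableRoots : ℝ)
  simp only [zero_re, sub_zero, re_ofReal_mul, ofReal_re] at hlim
  refine hlim.congr' ?_
  filter_upwards [hlog₀.eventually_le_atBot X₀, hlog₁.eventually_ge_atTop (max X₀ X₁),
    tendsto_fst.eventually self_mem_nhdsWithin,
    tendsto_snd.eventually (eventually_gt_atTop (0 : ℝ))] with p h1 h2 h3 h4
  have := key _ _ h1 h2
  rw [Real.exp_log h3, Real.exp_log h4] at this
  exact this.symm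

end FractionalDelay

/-! ### Part (b): the exponent conditions imply the large arc condition. -/

namespace FractionalDelay

open Complex Set

/-- The filter `re w → ∞` within the closed strip `|im w| ≤ π / 2`. -/
def stripAtTop : Filter ℂ :=
  comap re atTop ⊓ 𝓟 {w | w.im ∈ Icc (-(Real.pi / 2)) (Real.pi / 2)}

/-- `g` tends to zero in the mean over the vertical segments `|im w| ≤ π / 2` as `re w → ∞`. -/
def TendstoZeroInMean (g : ℂ → ℂ) : Prop :=
  Tendsto (fun x : ℝ => ∫⁻ θ in Icc (-(Real.pi / 2)) (Real.pi / 2), ‖g (x + θ * I)‖ₑ) atTop (𝓝 0)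

lemma eventually_stripAtTop {p : ℂ → Prop} (h : ∀ᶠ w in stripAtTop, p w) :
    ∀ᶠ x : ℝ in atTop, ∀ θ ∈ Icc (-(Real.pi / 2)) (Real.pi / 2), p (x + θ * I) := by
  rw [stripAtTop, eventually_inf_principal, eventually_comap] at h
  filter_upwards [h] with x hx θ hθ
  exact hx (x + θ * I) (by simp) (by simpa using hθ)

lemma tendsto_re_stripAtTop : Tendsto re stripAtTop atTop :=
  tendsto_comap.mono_left inf_le_left

lemma eventually_mem_strip :
    ∀ᶠ w in stripAtTop, w.im ∈ Icc (-(Real.pi / 2)) (Real.pi / 2) :=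
  mem_inf_of_right (mem_principal_self _)

namespace TendstoZeroInMean

variable {g h : ℂ → ℂ}

lemma of_tendsto (hg : Tendsto g stripAtTop (𝓝 0)) : TendstoZeroInMean g := by
  rw [TendstoZeroInMean, ENNReal.tendsto_nhds_zero]
  intro ε hε
  have hδ : 0 < ε / ENNReal.ofReal Real.pi := ENNReal.div_pos hε.ne' ENNReal.ofReal_ne_top
  filter_upwards [eventually_stripAtTop
    ((tendsto_zero_iff_enorm_tendsto_zero.1 hg).eventually_le_const hδ)] with x hx
  refine (setLIntegral_mono' measurableSet_Icc hx).trans ?_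
  rw [setLIntegral_const, Real.volume_Icc, sub_neg_eq_add, add_halves]
  exact (ENNReal.div_mul_cancel (by simpa using Real.pi_pos) ENNReal.ofReal_ne_top).le

lemma const_mul (c : ℂ) (hg : TendstoZeroInMean g) : TendstoZeroInMean fun w => c * g w := by
  have h1 := ENNReal.Tendsto.const_mul (a := ‖c‖ₑ) hg (.inr enorm_ne_top)
  rw [mul_zero] at h1
  refine h1.congr fun x => ?_
  rw [← lintegral_const_mul' _ _ enorm_ne_top]
  simp only [enorm_mul]

lemma add (hg : TendstoZeroInMean g) (hh : TendstoZeroInMean h) (hgm : Measurable g) :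
    TendstoZeroInMean fun w => g w + h w := by
  have h1 := Tendsto.add hg hh
  rw [add_zero] at h1
  refine tendsto_of_tendsto_of_tendsto_of_le_of_le tendsto_const_nhds h1 (fun _ => zero_le)
    fun x => ?_
  beta_reduce
  rw [← lintegral_add_left (by fun_prop)]
  exact lintegral_mono fun θ => enorm_add_le _ _

lemma sum {ι : Type*} (s : Finset ι) {g : ι → ℂ → ℂ} (hg : ∀ i ∈ s, TendstoZeroInMean (g i))
    (hgm : ∀ i ∈ s, Measurable (g i)) : TendstoZeroInMean fun w => ∑ i ∈ s, g i w := by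
  classical
  induction s using Finset.induction_on with
  | empty => simp [TendstoZeroInMean]
  | insert i s hi ih =>
    simp only [Finset.sum_insert hi]
    exact (hg i (by simp)).add (ih (fun j hj => hg j (by simp [hj])) fun j hj => hgm j (by simp [hj]))
      (hgm i (by simp))

lemma mono (hh : TendstoZeroInMean h) (hgh : ∀ᶠ w in stripAtTop, ‖g w‖ ≤ ‖h w‖) :
    TendstoZeroInMean g := by
  refine tendsto_of_tendsto_of_tendsto_of_le_of_le' tendsto_const_nhds hh
    (.of_forall fun _ => zero_le) ?_
  filter_upwards [eventually_stripAtTop hgh] with x hx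
  exact setLIntegral_mono' measurableSet_Icc fun θ hθ => enorm_le_iff_norm_le.2 (hx θ hθ)

end TendstoZeroInMean

lemma norm_exp_mul (c : ℝ) (w : ℂ) : ‖exp (c * w)‖ = Real.exp (c * w.re) := by
  rw [norm_exp, re_ofReal_mul]

lemma norm_exp_neg_mul_exp (ζ β : ℝ) (w : ℂ) :
    ‖exp (-ζ * exp (β * w))‖ = Real.exp (-(ζ * (Real.exp (β * w.re) * Real.cos (β * w.im)))) := by
  rw [norm_exp, ← ofReal_neg, re_ofReal_mul, exp_re, re_ofReal_mul, im_ofReal_mul, neg_mul]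

lemma tendsto_real_exp_mul_atTop {c : ℝ} (hc : c < 0) :
    Tendsto (fun x : ℝ => Real.exp (c * x)) atTop (𝓝 0) :=
  Real.tendsto_exp_atBot.comp (tendsto_id.const_mul_atTop_of_neg hc)

lemma tendsto_exp_mul_stripAtTop {c : ℝ} (hc : c < 0) :
    Tendsto (fun w => exp (c * w)) stripAtTop (𝓝 0) := by
  rw [tendsto_zero_iff_norm_tendsto_zero]
  simp only [norm_exp_mul]
  exact (tendsto_real_exp_mul_atTop hc).comp tendsto_re_stripAtTop

lemma abs_mul_le_of_mem_strip {β θ : ℝ} (hβ : 0 < β) (hθ : θ ∈ Icc (-(Real.pi / 2)) (Real.pi / 2)) :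
    |β * θ| ≤ β * (Real.pi / 2) := by
  rw [abs_mul, abs_of_pos hβ]
  exact mul_le_mul_of_nonneg_left (abs_le.2 hθ) hβ.le

/-- For `β ≤ 1` one has `cos (β θ) ≥ 0` on the strip, so the delay factor has modulus at most 1. -/
lemma tendsto_exp_mul_delay_of_neg {c ζ β : ℝ} (hc : c < 0) (hζ : 0 < ζ) (hβ : 0 < β)
    (hβ1 : β ≤ 1) :
    Tendsto (fun w => exp (c * w) * exp (-ζ * exp (β * w))) stripAtTop (𝓝 0) := by
  refine squeeze_zero_norm' ?_ ((tendsto_real_exp_mul_atTop hc).comp tendsto_re_stripAtTop)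
  filter_upwards [eventually_mem_strip] with w hw
  rw [norm_mul, norm_exp_mul, norm_exp_neg_mul_exp]
  refine mul_le_of_le_one_right (Real.exp_pos _).le (Real.exp_le_one_iff.2 ?_)
  have h1 := abs_le.1 (abs_mul_le_of_mem_strip hβ hw)
  have h2 : β * (Real.pi / 2) ≤ Real.pi / 2 :=
    mul_le_of_le_one_left (by linarith [Real.pi_pos]) hβ1
  have h3 : 0 ≤ Real.cos (β * w.im) :=
    Real.cos_nonneg_of_mem_Icc ⟨by linarith [h1.1], by linarith [h1.2]⟩
  have : 0 ≤ ζ * (Real.exp (β * w.re) * Real.cos (β * w.im)) := by positivity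
  linarith

/-- For `β < 1` the cosine stays above `κ = cos (β π/2) > 0`. With `y = exp (β re w)` the modulus is
at most `y ^ (c/β) * exp (-ζ κ y)`, which tends to 0 whatever the sign of `c`. -/
lemma tendsto_exp_mul_delay_of_lt_one (c : ℝ) {ζ β : ℝ} (hζ : 0 < ζ) (hβ : 0 < β)
    (hβ1 : β < 1) :
    Tendsto (fun w => exp (c * w) * exp (-ζ * exp (β * w))) stripAtTop (𝓝 0) := by
  have hlt : β * (Real.pi / 2) < Real.pi / 2 :=
    mul_lt_of_lt_one_left (by linarith [Real.pi_pos]) hβ1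
  have hpos : 0 < β * (Real.pi / 2) := by positivity
  set κ := Real.cos (β * (Real.pi / 2)) with hκ
  have hκ0 : 0 < κ := Real.cos_pos_of_mem_Ioo ⟨by linarith, hlt⟩
  have hlim := (tendsto_rpow_mul_exp_neg_mul_atTop_nhds_zero (c / β) (ζ * κ) (by positivity)).comp
    (Real.tendsto_exp_atTop.comp (tendsto_re_stripAtTop.const_mul_atTop hβ))
  refine squeeze_zero_norm' ?_ hlim
  filter_upwards [eventually_mem_strip] with w hw
  rw [norm_mul, norm_exp_mul, norm_exp_neg_mul_exp]
  simp only [Function.comp_apply]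
  rw [← Real.exp_mul, show β * w.re * (c / β) = c * w.re by field_simp]
  refine mul_le_mul_of_nonneg_left (Real.exp_le_exp.2 ?_) (Real.exp_pos _).le
  have h1 := abs_mul_le_of_mem_strip hβ hw
  have h2 : κ ≤ Real.cos (β * w.im) := by
    rw [← Real.cos_abs (β * w.im)]
    exact Real.cos_le_cos_of_nonneg_of_le_pi (abs_nonneg _) (by linarith [Real.pi_pos]) h1
  have h3 : ζ * (Real.exp (β * w.re) * κ) ≤ ζ * (Real.exp (β * w.re) * Real.cos (β * w.im)) := by
    gcongr
  linarith

/-- Jordan's inequality: cosine is concave and lies above its chords on each half of the interval.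
Adding both exponentials avoids splitting the integral at 0. -/
lemma exp_neg_mul_cos_le {k θ : ℝ} (hk : 0 < k) (hθ : θ ∈ Icc (-(Real.pi / 2)) (Real.pi / 2)) :
    Real.exp (-(k * Real.cos θ)) ≤
      Real.exp (-(k * (1 + 2 / Real.pi * θ))) + Real.exp (-(k * (1 - 2 / Real.pi * θ))) := by
  rcases le_total θ 0 with h | h
  · have h1 := Real.one_add_mul_le_cos hθ.1 h
    have h2 : Real.exp (-(k * Real.cos θ)) ≤ Real.exp (-(k * (1 + 2 / Real.pi * θ))) := by gcongr
    linarith [Real.exp_pos (-(k * (1 - 2 / Real.pi * θ)))]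
  · have h1 := Real.one_sub_mul_le_cos h hθ.2
    have h2 : Real.exp (-(k * Real.cos θ)) ≤ Real.exp (-(k * (1 - 2 / Real.pi * θ))) := by gcongr
    linarith [Real.exp_pos (-(k * (1 + 2 / Real.pi * θ)))]

lemma integral_jordan_bound {k : ℝ} (hk : 0 < k) :
    ∫ θ in (-(Real.pi / 2))..(Real.pi / 2),
      (Real.exp (-(k * (1 + 2 / Real.pi * θ))) + Real.exp (-(k * (1 - 2 / Real.pi * θ)))) ≤
      Real.pi / k := by
  have hpi := Real.pi_pos
  have hd : ∀ θ : ℝ, HasDerivAt (fun θ : ℝ => Real.pi / (2 * k) *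
      (Real.exp (-(k * (1 - 2 / Real.pi * θ))) - Real.exp (-(k * (1 + 2 / Real.pi * θ)))))
      (Real.exp (-(k * (1 + 2 / Real.pi * θ))) + Real.exp (-(k * (1 - 2 / Real.pi * θ)))) θ := by
    intro θ
    have h0 := (hasDerivAt_id θ).const_mul (2 / Real.pi)
    have h1 := ((h0.const_sub 1).const_mul k).neg.exp
    have h2 := ((h0.const_add 1).const_mul k).neg.exp
    refine ((h1.sub h2).const_mul (Real.pi / (2 * k))).congr_deriv ?_
    simp only [id_eq, Pi.neg_apply]
    field_simp
    ring
  rw [intervalIntegral.integral_eq_sub_of_hasDerivAt (fun θ _ => hd θ)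
    (by apply Continuous.intervalIntegrable; fun_prop)]
  have e1 : -(k * (1 - 2 / Real.pi * (Real.pi / 2))) = 0 := by field_simp; ring
  have e2 : -(k * (1 + 2 / Real.pi * (Real.pi / 2))) = -(2 * k) := by field_simp; ring
  have e3 : -(k * (1 - 2 / Real.pi * -(Real.pi / 2))) = -(2 * k) := by field_simp; ring
  have e4 : -(k * (1 + 2 / Real.pi * -(Real.pi / 2))) = 0 := by field_simp; ring
  rw [e1, e2, e3, e4, Real.exp_zero, ← mul_sub]
  have h3 : Real.pi / k = Real.pi / (2 * k) * 2 := by field_simp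
  rw [h3]
  refine mul_le_mul_of_nonneg_left ?_ (by positivity)
  linarith [Real.exp_pos (-(2 * k))]

/-- At `θ = ±π/2` the modulus is `exp (c x)`, which does not decay for `0 ≤ c < 1`. Integration over
`θ` gains `π / (ζ exp x)` by `integral_jordan_bound`, hence the condition `c < 1`. -/
lemma tendstoZeroInMean_exp_mul_delay_one {c ζ : ℝ} (hc : c < 1) (hζ : 0 < ζ) :
    TendstoZeroInMean fun w => exp (c * w) * exp (-ζ * exp ((1 : ℝ) * w)) := by
  have hlim : Tendsto (fun x : ℝ => ENNReal.ofReal (Real.pi / ζ * Real.exp ((c - 1) * x))) atTop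
      (𝓝 0) := by
    have := ENNReal.tendsto_ofReal
      ((tendsto_real_exp_mul_atTop (sub_neg.2 hc)).const_mul (Real.pi / ζ))
    simpa using this
  refine tendsto_of_tendsto_of_tendsto_of_le_of_le tendsto_const_nhds hlim (fun _ => zero_le)
    fun x => ?_
  have hk : 0 < ζ * Real.exp x := mul_pos hζ (Real.exp_pos x)
  set J : ℝ → ℝ := fun θ => Real.exp (-(ζ * Real.exp x * (1 + 2 / Real.pi * θ))) +
    Real.exp (-(ζ * Real.exp x * (1 - 2 / Real.pi * θ))) with hJ
  have hJc : Continuous J := by fun_prop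
  calc ∫⁻ θ in Icc (-(Real.pi / 2)) (Real.pi / 2),
        ‖exp (c * (x + θ * I)) * exp (-ζ * exp ((1 : ℝ) * (x + θ * I)))‖ₑ
      ≤ ∫⁻ θ in Icc (-(Real.pi / 2)) (Real.pi / 2), ENNReal.ofReal (Real.exp (c * x) * J θ) := by
        refine setLIntegral_mono' measurableSet_Icc fun θ hθ => ?_
        rw [← ofReal_norm, norm_mul, norm_exp_mul, norm_exp_neg_mul_exp]
        refine ENNReal.ofReal_le_ofReal ?_
        have := exp_neg_mul_cos_le hk hθ
        simp only [add_re, ofReal_re, re_ofReal_mul, I_re, mul_zero, add_zero, add_im, ofReal_im,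
          im_ofReal_mul, I_im, mul_one, zero_add, one_mul]
        rw [← mul_assoc ζ]
        gcongr
    _ = ENNReal.ofReal (∫ θ in Icc (-(Real.pi / 2)) (Real.pi / 2), Real.exp (c * x) * J θ) := by
        rw [ofReal_integral_eq_lintegral_ofReal]
        · exact (continuous_const.mul hJc).continuousOn.integrableOn_Icc
        · exact .of_forall fun θ => by positivity
    _ ≤ ENNReal.ofReal (Real.pi / ζ * Real.exp ((c - 1) * x)) := by
        refine ENNReal.ofReal_le_ofReal ?_
        rw [integral_const_mul, integral_Icc_eq_integral_Ioc, ← intervalIntegral.integral_of_le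
          (by linarith [Real.pi_pos])]
        refine (mul_le_mul_of_nonneg_left (integral_jordan_bound hk) (Real.exp_pos _).le).trans_eq ?_
        rw [sub_mul, one_mul, Real.exp_sub]
        field_simp

variable {D : FractionalDelay}

lemma exp_ofReal_mul_mul_exp (a b : ℝ) (w : ℂ) :
    exp (a * w) * exp (b * w) = exp ((a + b : ℝ) * w) := by
  rw [← Complex.exp_add]
  push_cast
  ring_nf

/-- `s ^ (-αₙ) Δ(s)` in the logarithmic coordinate. -/
lemma normalized_logΔ_eq (w : ℂ) :
    exp ((-D.leadingExp : ℝ) * w) * D.logΔ w =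
      1 + ∑ k : Fin D.m, (D.a k : ℂ) * exp ((-D.leadingExp + D.α k.castSucc : ℝ) * w) +
      D.a₀ * exp ((-D.leadingExp : ℝ) * w) +
      ∑ i : Fin D.N, ∑ k : Fin (D.M i), (D.b i k : ℂ) *
        (exp ((-D.leadingExp + D.γ i k : ℝ) * w) * exp (-D.ζ i * exp (D.β i * w))) := by
  have h1 : (1 : ℂ) = exp ((-D.leadingExp : ℝ) * w) * exp (D.leadingExp * w) := by
    rw [exp_ofReal_mul_mul_exp]; simp
  rw [h1, logΔ]
  simp only [← exp_ofReal_mul_mul_exp, mul_add, Finset.mul_sum, Finset.sum_mul]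
  refine congrArg₂ _ (congrArg₂ _ (congrArg₂ _ rfl ?_) (mul_comm _ _)) ?_
  · exact Finset.sum_congr rfl fun k _ => by ring
  · exact Finset.sum_congr rfl fun i _ => Finset.sum_congr rfl fun k _ => by ring

/-- The leading terms cancel. Differentiating a delay factor raises the exponent by `β`; when `β =
1` these are the terms that call for convergence in the mean. -/
lemma normalized_logΔ'_sub_eq (w : ℂ) :
    exp ((-D.leadingExp : ℝ) * w) * (D.logΔ' w - D.leadingExp * D.logΔ w) =
      ((∑ k : Fin D.m, (D.a k * (D.α k.castSucc - D.leadingExp) : ℂ) *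
        exp ((-D.leadingExp + D.α k.castSucc : ℝ) * w)) +
      (-D.leadingExp * D.a₀ : ℂ) * exp ((-D.leadingExp : ℝ) * w)) +
      ∑ i : Fin D.N, ∑ k : Fin (D.M i),
        ((D.b i k * (D.γ i k - D.leadingExp) : ℂ) *
          (exp ((-D.leadingExp + D.γ i k : ℝ) * w) * exp (-D.ζ i * exp (D.β i * w))) +
        (-(D.b i k * D.ζ i * D.β i) : ℂ) *
          (exp ((-D.leadingExp + D.γ i k + D.β i : ℝ) * w) * exp (-D.ζ i * exp (D.β i * w)))) := by
  simp only [← exp_ofReal_mul_mul_exp]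
  have h1 : D.logΔ' w - D.leadingExp * D.logΔ w =
      ((∑ k : Fin D.m, (D.a k : ℂ) * (D.α k.castSucc * exp (D.α k.castSucc * w))) -
        D.leadingExp * ∑ k : Fin D.m, (D.a k : ℂ) * exp (D.α k.castSucc * w)) -
      D.leadingExp * D.a₀ +
      ((∑ i : Fin D.N, ∑ k : Fin (D.M i), (D.b i k : ℂ) *
        (D.γ i k - D.ζ i * D.β i * exp (D.β i * w)) *
        exp (D.γ i k * w) * exp (-D.ζ i * exp (D.β i * w))) -
      D.leadingExp * ∑ i : Fin D.N, (∑ k : Fin (D.M i), (D.b i k : ℂ) * exp (D.γ i k * w)) *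
        exp (-D.ζ i * exp (D.β i * w))) := by
    rw [logΔ, logΔ']
    ring
  rw [h1, mul_add, mul_sub]
  simp only [Finset.mul_sum, Finset.sum_mul, ← Finset.sum_sub_distrib]
  rw [sub_eq_add_neg]
  refine congrArg₂ _ (congrArg₂ _ ?_ (by ring)) ?_
  · exact Finset.sum_congr rfl fun k _ => by ring
  · exact Finset.sum_congr rfl fun i _ => Finset.sum_congr rfl fun k _ => by ring

lemma tendsto_normalized_logΔ
    (h : ∀ i, D.β i < 1 ∨ (D.β i = 1 ∧ ∀ k, D.γ i k < D.leadingExp)) :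
    Tendsto (fun w => exp ((-D.leadingExp : ℝ) * w) * D.logΔ w) stripAtTop (𝓝 1) := by
  simp only [normalized_logΔ_eq]
  have h1 : Tendsto (fun w => ∑ k : Fin D.m, (D.a k : ℂ) *
      exp ((-D.leadingExp + D.α k.castSucc : ℝ) * w)) stripAtTop (𝓝 (∑ k : Fin D.m, 0)) :=
    tendsto_finsetSum _ fun k _ => by
      simpa using (tendsto_exp_mul_stripAtTop (c := -D.leadingExp + D.α k.castSucc)
        (by linarith [D.α_castSucc_lt_leadingExp k])).const_mul (D.a k : ℂ)
  have h2 := (tendsto_exp_mul_stripAtTop (neg_neg_of_pos D.leadingExp_pos)).const_mul (D.a₀ : ℂ)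
  have h3 : Tendsto (fun w => ∑ i : Fin D.N, ∑ k : Fin (D.M i), (D.b i k : ℂ) *
      (exp ((-D.leadingExp + D.γ i k : ℝ) * w) * exp (-D.ζ i * exp (D.β i * w)))) stripAtTop
      (𝓝 (∑ i : Fin D.N, ∑ k : Fin (D.M i), 0)) := by
    refine tendsto_finsetSum _ fun i _ => tendsto_finsetSum _ fun k _ => ?_
    have h4 : Tendsto (fun w => exp ((-D.leadingExp + D.γ i k : ℝ) * w) *
        exp (-D.ζ i * exp (D.β i * w))) stripAtTop (𝓝 0) := by
      rcases h i with hβ | ⟨hβ, hγ⟩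
      · exact tendsto_exp_mul_delay_of_lt_one _ (D.ζ_pos i) (D.β_pos i) hβ
      · exact tendsto_exp_mul_delay_of_neg (by linarith [hγ k]) (D.ζ_pos i) (D.β_pos i) hβ.le
    simpa using h4.const_mul (D.b i k : ℂ)
  simpa using ((h1.const_add 1).add h2).add h3

lemma tendstoZeroInMean_normalized_logΔ'_sub
    (h : ∀ i, D.β i < 1 ∨ (D.β i = 1 ∧ ∀ k, D.γ i k < D.leadingExp)) :
    TendstoZeroInMean fun w =>
      exp ((-D.leadingExp : ℝ) * w) * (D.logΔ' w - D.leadingExp * D.logΔ w) := by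
  simp only [normalized_logΔ'_sub_eq]
  refine .add (.add (.sum _ (fun k _ => .const_mul _ (.of_tendsto (tendsto_exp_mul_stripAtTop
    (by linarith [D.α_castSucc_lt_leadingExp k])))) fun _ _ => by fun_prop)
    (.const_mul _ (.of_tendsto (tendsto_exp_mul_stripAtTop (neg_neg_of_pos D.leadingExp_pos))))
    (by fun_prop)) (.sum _ (fun i _ => .sum _ (fun k _ => ?_) fun _ _ => by fun_prop)
      fun _ _ => by fun_prop) (by fun_prop)
  rcases h i with hβ | ⟨hβ, hγ⟩
  · exact .add
      (.const_mul _ (.of_tendsto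
        (tendsto_exp_mul_delay_of_lt_one _ (D.ζ_pos i) (D.β_pos i) hβ)))
      (.const_mul _ (.of_tendsto
        (tendsto_exp_mul_delay_of_lt_one _ (D.ζ_pos i) (D.β_pos i) hβ)))
      (by fun_prop)
  · refine .add
      (.const_mul _ (.of_tendsto
        (tendsto_exp_mul_delay_of_neg (by linarith [hγ k]) (D.ζ_pos i) (D.β_pos i) hβ.le)))
      (.const_mul _ ?_) (by fun_prop)
    rw [hβ]
    exact tendstoZeroInMean_exp_mul_delay_one (by linarith [hγ k]) (D.ζ_pos i)

theorem largeArcLimit_of_exponents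
    (h : ∀ i, D.β i < 1 ∨ (D.β i = 1 ∧ ∀ k, D.γ i k < D.leadingExp)) : D.LargeArcLimit := by
  rw [largeArcLimit_iff]
  refine TendstoZeroInMean.mono (g := fun w => logDeriv D.logΔ w - D.leadingExp)
    ((tendstoZeroInMean_normalized_logΔ'_sub h).const_mul 2) ?_
  -- The normalized denominator tends to 1, so eventually its modulus exceeds 1/2; this accounts for
  -- the factor 2 above.
  have hhalf : (1 / 2 : ℝ) < ‖(1 : ℂ)‖ := by norm_num
  filter_upwards [(tendsto_normalized_logΔ h).norm.eventually_const_lt hhalf] with w hw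
  have hne : exp ((-D.leadingExp : ℝ) * w) * D.logΔ w ≠ 0 :=
    norm_pos_iff.1 (by linarith)
  have heq : logDeriv D.logΔ w - D.leadingExp =
      exp ((-D.leadingExp : ℝ) * w) * (D.logΔ' w - D.leadingExp * D.logΔ w) /
        (exp ((-D.leadingExp : ℝ) * w) * D.logΔ w) := by
    rw [mul_div_mul_left _ _ (exp_ne_zero _), sub_div,
      mul_div_cancel_right₀ _ (right_ne_zero_of_mul hne), logDeriv_apply, deriv_logΔ]
  rw [heq, norm_div, div_le_iff₀ (by linarith), norm_mul 2, norm_ofNat]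
  nlinarith [norm_nonneg (exp ((-D.leadingExp : ℝ) * w) * (D.logΔ' w - D.leadingExp * D.logΔ w))]

end FractionalDelay

theorem mainTheorem1 (D : FractionalDelay) :
    (D.NonzeroAtOrigin → (∀ ω : ℝ, ω ≠ 0 → D.Δ (ω * Complex.I) ≠ 0) → D.LargeArcLimit →
      D.unstableRoots.Finite ∧
      ∃ J : ℝ,
        Tendsto
          (fun p : ℝ × ℝ =>
            ∫ ω in p.1..p.2, (deriv D.Δ (ω * Complex.I) / D.Δ (ω * Complex.I)).re)
          (𝓝[>] (0 : ℝ) ×ˢ atTop) (𝓝 J) ∧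
        (D.numUnstableRoots : ℝ) = D.leadingExp / 2 - 1 / Real.pi * J) ∧
    ((∀ i, D.β i < 1 ∨ (D.β i = 1 ∧ ∀ k, D.γ i k < D.leadingExp)) → D.LargeArcLimit) := by
  refine ⟨fun h₀ hne h => ?_, FractionalDelay.largeArcLimit_of_exponents⟩
  obtain ⟨hfin, hlim⟩ := FractionalDelay.argument_principle_of_largeArcLimit h₀ hne h
  refine ⟨hfin, _, hlim, ?_⟩
  have := Real.pi_ne_zero
  field_simp
  ring
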